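/- Let $\Gamma$ be a 2-colex: a finite cubic graph cellularly embedded in a closed oriented surface (of any genus) whose faces are properly 3-colored; write $v\in f$ if the vertex $v$ lies on the face $f$. **The code.** Let $\mathcal H_\Gamma$ be the hypergraph obtained from $\Gamma$ by vertex expansion: each vertex $v$ is replaced by a rank-3 edge (triangle) $\{v_1,v_2,v_3\}$ with one qubit in each of the three corners at $v$, and each edge of $\Gamma$ is split into two rank-2 edges, one on each side, each joining the two corners at its ends on that side. Thus every qubit belongs to exactly one face $f$ of $\Gamma$, and the qubits of $f$ are joined in a cycle of rank-2 edges. Color the rank-2 edges red and green, alternating around every rank-3 edge. The gauge group $\mathcal G$ is generated by $X_uX_v$ for red edges $\{u,v\}$, $Y_uY_v$ for green edges $\{u,v\}$, and $Z_uZ_v$ for distinct $u,v$ in a common rank-3 edge. For each face $f$ let $W_1^f=\prod_{q\in f}Z_q$ (rank-2 stabilizer), and let $W_2^f$ (rank-3 stabilizer) be the product of $X_uY_vY_w$ over the rank-3 edges that meet $f$, namely (up to sign) the cycle operator of the hypercycle consisting of those rank-3 edges, the red rank-2 edges inside $f$, and the rank-2 edges running along $f$ on the other side of each of its edges. The syndrome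 $s\in\{0,1\}$ of an error $E$ with respect to an operator $W$ is given by $WE=(-1)^sEW$. Pauli operators are called equivalent modulo a group $H$ if they differ by an element of $\langle iI,H\rangle$. The color code on $\Gamma$ has one qubit per vertex and stabilizer $S_\Gamma$ generated by $B_f^X=\prod_{v\in f}X_v$ and $B_f^Z=\prod_{v\in f}Z_v$. For a $Z$-type error $F$ on $\mathcal H_\Gamma$ let $\pi(F)$ be the $Z$-type error on $\Gamma$ determined by $\pi(Z_{v_1})=\pi(Z_{v_2})=\pi(Z_{v_3})=Z_v$. A color code decoder $D$ is any map that, given the syndrome (with respect to the $B_f^X$) of some $Z$-type error on $\Gamma$, returns a $Z$-type error with that syndrome. **The algorithm.** Input: $s^1_f,s^2_f\in\{0,1\}$ for all faces $f$. (1) Start with $\hat E=I$. For each face $f$ in turn, if $s^1_f\ne0$, choose any one qubit $q$ of $f$, replace $\hat E$ by $\hat E X_q$, and flip $s^2_f$ and $s^2_{f'}$, where $f'$ is the face adjacent to $f$ for which $W_2^{f'}$ anticommutes with $X_q$. Let $\hat E_X$ be the resulting $\hat E$ and $\tilde s$ the updated rank-3 syndrome. (2) Let $E'=D(\tilde s)$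 be the estimate on $\Gamma$. For each vertex $v$ in the support of $E'$ multiply $\hat E$ by $Z_{v_1}Z_{v_2}Z_{v_3}$ (or, alternatively, by a single $Z_{v_i}$). Return $\hat E$. **Theorem.** Let $E$ be any Pauli error on the qubits of $\mathcal H_\Gamma$, with syndromes $s^1_f,s^2_f$ with respect to $W_1^f,W_2^f$. For every color code decoder $D$ and all choices made in the algorithm, run on this input: 1. in step (1), for each face $f$ and each qubit $q$ of $f$ there is exactly one face $f'$ as described; 2. after step (1), the residual error $E\hat E_X$ has trivial rank-2 syndromes, its rank-3 syndrome is $\tilde s$, and it is equivalent modulo $\mathcal G$ to a $Z$-type error; 3. for every $Z$-type error $F$ equivalent modulo $\mathcal G$ to $E\hat E_X$, the syndrome of $\pi(F)$ in the color code is $\tilde s$; moreover, $\hat E$ is equivalent to $E$ modulo $\mathcal G$ if and only if $E'$ is equivalent to $\pi(F)$ modulo $S_\Gamma$; 4. the output $\hat E$ has the input syndromes $s^1_f,s^2_f$ for all $f$; more generally, $\hat E$ and $E$ have the same syndrome with respect to every element of the stabilizer $\mathcal G\cap C(\mathcal G)$ of the subsystem code. -/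

import Mathlib

/-! ### The Pauli group on a finite set of qubits -/

/-- The Pauli group on the qubits `Q`: the triple `(k, a, b)` is the operator
`i ^ k * X ^ a * Z ^ b`, where `X ^ a` is the product of `X_q` over all `q` with `a q = 1`, and
similarly for `Z ^ b`. -/
@[ext]
structure Pauli (Q : Type*) where
  phase : ZMod 4
  x : Q → ZMod 2
  z : Q → ZMod 2

namespace Pauli

/-- The exponent of `i` in `(-1) ^ s`. -/
def signPhase (s : ZMod 2) : ZMod 4 := if s = 0 then 0 else 2

theorem signPhase_add (s t : ZMod 2) : signPhase (s + t) = signPhase s + signPhase t := by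
  revert s t; decide

instance {Q : Type*} : One (Pauli Q) := ⟨⟨0, 0, 0⟩⟩

theorem one_def {Q : Type*} : (1 : Pauli Q) = ⟨0, 0, 0⟩ := rfl

variable {Q : Type*} [Fintype Q]

/-- Since `Z ^ b * X ^ a = (-1) ^ (b ⬝ a) * X ^ a * Z ^ b`. -/
instance : Mul (Pauli Q) :=
  ⟨fun g h => ⟨g.phase + h.phase + signPhase (g.z ⬝ᵥ h.x), g.x + h.x, g.z + h.z⟩⟩

instance : Inv (Pauli Q) := ⟨fun g => ⟨-g.phase + signPhase (g.z ⬝ᵥ g.x), g.x, g.z⟩⟩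

theorem mul_def (g h : Pauli Q) :
    g * h = ⟨g.phase + h.phase + signPhase (g.z ⬝ᵥ h.x), g.x + h.x, g.z + h.z⟩ := rfl

theorem inv_def (g : Pauli Q) : g⁻¹ = ⟨-g.phase + signPhase (g.z ⬝ᵥ g.x), g.x, g.z⟩ := rfl

instance : Group (Pauli Q) :=
  Group.ofLeftAxioms
    (by
      intro g h k
      simp only [mul_def, Pauli.mk.injEq, add_dotProduct, dotProduct_add, signPhase_add]
      refine ⟨by abel, by abel, by abel⟩)
    (by
      intro g
      simp [mul_def, one_def, signPhase])
    (by
      intro g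
      have h2 : ∀ a : Q → ZMod 2, a + a = 0 := fun a => by
        funext q; exact CharTwo.add_self_eq_zero _
      have h4 : ∀ s : ZMod 2, signPhase s + signPhase s = 0 := by decide
      simp only [mul_def, inv_def, one_def, Pauli.mk.injEq, h2, and_true]
      rw [show -g.phase + signPhase (g.z ⬝ᵥ g.x) + g.phase + signPhase (g.z ⬝ᵥ g.x)
        = signPhase (g.z ⬝ᵥ g.x) + signPhase (g.z ⬝ᵥ g.x) by abel, h4])

/-- The scalar operator `i ^ k * I`. -/
def scalar (Q : Type*) (k : ZMod 4) : Pauli Q := ⟨k, 0, 0⟩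

open Classical in
/-- The outcome `s` of measuring `g` in the presence of `e`, where `g e = (-1) ^ s e g`:
it is `0` if the two operators commute and `1` if they anticommute. -/
noncomputable def syndrome (g e : Pauli Q) : ZMod 2 := if g * e = e * g then 0 else 1

theorem mul_eq_sign_syndrome (g e : Pauli Q) :
    g * e = scalar Q (signPhase (syndrome g e)) * (e * g) := by
  have key : ∀ s t : ZMod 2, signPhase s ≠ signPhase t → signPhase s = 2 + signPhase t := by
    decide
  unfold syndrome
  split_ifs with h
  · rw [h]; simp [scalar, mul_def, signPhase]
  · have h1 : signPhase (g.z ⬝ᵥ e.x) ≠ signPhase (e.z ⬝ᵥ g.x) := by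
      intro h2
      apply h
      simp only [mul_def, h2, Pauli.mk.injEq]
      refine ⟨by abel, by abel, by abel⟩
    have h3 := key _ _ h1
    have h4 : signPhase 1 = 2 := by decide
    have h5 : signPhase 0 = 0 := by decide
    simp only [mul_def, scalar, h3, h4, h5, Pauli.mk.injEq, zero_dotProduct, zero_add]
    refine ⟨by abel, by abel, by abel⟩

/-- The one-qubit Pauli operators. -/
inductive Letter
  | I
  | X
  | Y
  | Z

namespace Letter

def xBit : Letter → ZMod 2
  | I => 0
  | X => 1
  | Y => 1
  | Z => 0

def zBit : Letter → ZMod 2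
  | I => 0
  | X => 0
  | Y => 1
  | Z => 1

/-- `Y = i X Z`. -/
def phase : Letter → ZMod 4
  | Y => 1
  | _ => 0

end Letter

/-- The tensor product of one-qubit Pauli operators, `p q` acting on the qubit `q`. -/
def tensor (p : Q → Letter) : Pauli Q :=
  ⟨∑ q, (p q).phase, fun q => (p q).xBit, fun q => (p q).zBit⟩

open Classical in
/-- `∏ q ∈ s, A_q`, the letter `A` acting on every qubit of `s`. -/
noncomputable def onSet (A : Letter) (s : Set Q) : Pauli Q :=
  tensor fun q => if q ∈ s then A else Letter.I

/-- A `Z`-type error: a product of operators `Z_q`, up to a global phase. -/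
def IsZType (g : Pauli Q) : Prop := g.x = 0

/-- The qubits on which `g` acts nontrivially. -/
def support (g : Pauli Q) : Set Q := {q | g.x q ≠ 0 ∨ g.z q ≠ 0}

/-- The group `⟨iI, H⟩`. -/
def withPhases (H : Subgroup (Pauli Q)) : Subgroup (Pauli Q) :=
  Subgroup.closure (Set.range (scalar Q)) ⊔ H

/-- `g` and `h` differ by an element of `H`, up to a global phase. -/
def EquivMod (H : Subgroup (Pauli Q)) (g h : Pauli Q) : Prop := g * h⁻¹ ∈ withPhases H

end Pauli

/-! ### 2-colexes -/

/-- A cubic graph cellularly embedded in a closed oriented surface, as a rotation system on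
the set `D` of darts (oriented edges). `next d` is the dart that follows `d` counterclockwise among
the darts leaving the same vertex, and `rev d` is the same edge with the opposite orientation. -/
structure CubicMap (D : Type*) where
  next : Equiv.Perm D
  rev : Equiv.Perm D
  next_ne : ∀ d, next d ≠ d
  next_next_next : ∀ d, next (next (next d)) = d
  rev_ne : ∀ d, rev d ≠ d
  rev_rev : ∀ d, rev (rev d) = d

namespace CubicMap

variable {D : Type*} (Γ : CubicMap D)

/-- The dart that follows `d` along the boundary of the face on the left of `d`. -/
def along : Equiv.Perm D := Γ.rev.trans Γ.next.symm

/-- The vertices are the orbits of `next`. -/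
def Vertex : Type _ := Quotient (Equiv.Perm.SameCycle.setoid Γ.next)

/-- The faces are the orbits of `along`. -/
def Face : Type _ := Quotient (Equiv.Perm.SameCycle.setoid Γ.along)

/-- The vertex from which the dart `d` leaves. -/
def vertex (d : D) : Γ.Vertex := Quotient.mk _ d

/-- The face on the left of the dart `d`. -/
def face (d : D) : Γ.Face := Quotient.mk _ d

instance [Finite D] : Finite Γ.Vertex := by unfold Vertex; infer_instance

noncomputable instance [Finite D] : Fintype Γ.Vertex := Fintype.ofFinite _

/-- The vertex `v` lies on the face `f`. -/
def OnFace (v : Γ.Vertex) (f : Γ.Face) : Prop := ∃ d, Γ.vertex d = v ∧ Γ.face d = f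

/-- The faces `f` and `g` lie on the two sides of an edge. -/
def Adjacent (f g : Γ.Face) : Prop := ∃ d, Γ.face d = f ∧ Γ.face (Γ.rev d) = g

end CubicMap

/-- A 2-colex: an embedded cubic graph whose faces are 3-colorable. -/
structure TwoColex (D : Type*) extends CubicMap D where
  colorable : ∃ color : toCubicMap.Face → Fin 3,
    ∀ d, color (toCubicMap.face d) ≠ color (toCubicMap.face (rev d))

namespace TwoColex

variable {D : Type*} [Fintype D] (Γ : TwoColex D)

open Pauli

/-! ### The color code on a 2-colex -/

/-- `B_f^X`. -/
noncomputable def colorX (f : Γ.Face) : Pauli Γ.Vertex := onSet Letter.X {v | Γ.OnFace v f}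

/-- `B_f^Z`. -/
noncomputable def colorZ (f : Γ.Face) : Pauli Γ.Vertex := onSet Letter.Z {v | Γ.OnFace v f}

/-- The stabilizer of the color code. -/
noncomputable def colorStabilizer : Subgroup (Pauli Γ.Vertex) :=
  Subgroup.closure (Set.range Γ.colorX ∪ Set.range Γ.colorZ)

/-- The syndrome of an error with respect to the stabilizers `B_f^X`, which detect the
`Z` errors. -/
noncomputable def colorSyndrome (e : Pauli Γ.Vertex) : Γ.Face → ZMod 2 :=
  fun f => syndrome (Γ.colorX f) e

/-- A decoder for the `Z` errors of the color code: given the syndrome of some `Z`-type error it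
returns a `Z`-type error with that syndrome. -/
def IsColorDecoder (dec : (Γ.Face → ZMod 2) → Pauli Γ.Vertex) : Prop :=
  ∀ e : Pauli Γ.Vertex, e.IsZType →
    (dec (Γ.colorSyndrome e)).IsZType ∧
      Γ.colorSyndrome (dec (Γ.colorSyndrome e)) = Γ.colorSyndrome e

/-! ### Vertex expansion and the topological subsystem color code

Every vertex of `Γ` is expanded into a triangle (a rank-3 edge), with one qubit in each of the three
corners at the vertex. The corner between `d` and `next d`, which belongs to `Γ.vertex d` and to
`Γ.face d`, is named after `d`; so the qubits are the elements of `D`.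
Every edge of `Γ` is split into two rank-2 edges, one on each side. The one on the left of the dart
`d` joins the corners `d` and `along d`; so the rank-2 edges are named by the elements of `D` too.
The rank-2 edges around the triangle of `d` are, counterclockwise,
`d`, `along⁻¹ d`, `next d`, `along⁻¹ (next d)`, `next (next d)`, `along⁻¹ (next (next d))`,
of which the first two meet at the corner `d`, the next two at the corner `next d`, and the last
two at the corner `next (next d)`. -/

/-- A coloring of the rank-2 edges in red and green, alternating around every rank-3 edge. -/
structure RankTwoColoring where
  red : D → Prop
  alt_corner : ∀ d, red (Γ.along.symm d) ↔ ¬ red d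
  alt_between : ∀ d, red (Γ.next d) ↔ ¬ red (Γ.along.symm d)

/-- The three qubits of the rank-3 edge that replaces the vertex `v`. -/
def triangle (v : Γ.Vertex) : Set D := {q | Γ.vertex q = v}

variable {Γ}

open Classical in
/-- The link operator of the rank-2 edge `d`: `XX` on a red edge, `YY` on a green edge. -/
noncomputable def linkOp (c : Γ.RankTwoColoring) (d : D) : Pauli D :=
  if c.red d then onSet Letter.X {d, Γ.along d} else onSet Letter.Y {d, Γ.along d}

/-- The gauge group, generated by the link operators of the rank-2 edges and by `Z_u Z_v` for
the pairs of distinct qubits of a rank-3 edge. -/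
noncomputable def gaugeGroup (c : Γ.RankTwoColoring) : Subgroup (Pauli D) :=
  Subgroup.closure
    (Set.range (linkOp c) ∪
      {g | ∃ u v, u ≠ v ∧ Γ.vertex u = Γ.vertex v ∧ g = onSet Letter.Z {u, v}})

/-- The stabilizer of the subsystem code, `G ∩ C(G)`. -/
noncomputable def stabilizer (c : Γ.RankTwoColoring) : Subgroup (Pauli D) :=
  gaugeGroup c ⊓ Subgroup.centralizer (gaugeGroup c : Set (Pauli D))

variable (Γ) in
/-- The rank-2 stabilizer `W_1^f`: the product of `Z_q` over the qubits of the face `f`. -/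
noncomputable def W₁ (f : Γ.Face) : Pauli D := onSet Letter.Z {q | Γ.face q = f}

open Classical in
/-- The rank-3 stabilizer `W_2^f`: the product of `X_u Y_v Y_w` over the rank-3 edges that meet `f`.
It is the cycle operator of the hypercycle that consists of the triangles around `f`, the red
rank-2 edges inside `f`, and the other side of each edge of `f`. The qubit inside `f` lies on a
triangle and a red edge, which gives `Y`. Each of the two others lies on the triangle and on the
rank-2 edge that runs along `f` outside `f`: this gives `Y` if that edge is red and `X` if it is
green. For the corner `next d` of a corner `d` of `f` that edge is `next d`, and for the
corner `next⁻¹ d` it is `along⁻¹ (next⁻¹ d)`. -/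
noncomputable def W₂ (c : Γ.RankTwoColoring) (f : Γ.Face) : Pauli D :=
  tensor fun q =>
    if Γ.face q = f then Letter.Y
    else if Γ.face (Γ.next.symm q) = f then (if c.red q then Letter.Y else Letter.X)
    else if Γ.face (Γ.next q) = f then
      (if c.red (Γ.along.symm q) then Letter.Y else Letter.X)
    else Letter.I

open Classical in
variable (Γ) in
/-- The projection of a `Z`-type error to the color code: `π(Z_q) = Z_v` for the three
qubits `q` of the triangle of `v`. -/
noncomputable def proj (e : Pauli D) : Pauli Γ.Vertex :=
  ⟨e.phase, 0, fun v => ∑ q with Γ.vertex q = v, e.z q⟩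

/-! ### The decoding algorithm -/

/-- The error estimate and the current rank-3 syndromes. -/
structure DecoderState (Γ : TwoColex D) where
  est : Pauli D
  syn : Γ.Face → ZMod 2

/-- The face `g` is adjacent to `f`, and `W_2^g` anticommutes with `X_q`. -/
def Affected (c : Γ.RankTwoColoring) (f : Γ.Face) (q : D) (g : Γ.Face) : Prop :=
  Γ.Adjacent f g ∧ syndrome (W₂ c g) (onSet Letter.X {q}) = 1

open Classical in
/-- One turn of the loop that corrects the `X` errors. If the rank-2 syndrome of `f` is nontrivial,
then apply `X` to the chosen qubit of `f`, and flip the rank-3 syndrome of `f` and of the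
adjacent face affected. -/
noncomputable def xStep (c : Γ.RankTwoColoring) (pick : Γ.Face → D) (s₁ : Γ.Face → ZMod 2)
    (st : DecoderState Γ) (f : Γ.Face) : DecoderState Γ :=
  if s₁ f ≠ 0 then
    { est := st.est * onSet Letter.X {pick f}
      syn := fun g => if g = f ∨ Affected c f (pick f) g then st.syn g + 1 else st.syn g }
  else st

/-- The loop that corrects the `X` errors, over the list `faces` of all faces. -/
noncomputable def xPhase (c : Γ.RankTwoColoring) (faces : List Γ.Face) (pick : Γ.Face → D)
    (s₁ s₂ : Γ.Face → ZMod 2) : DecoderState Γ :=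
  faces.foldl (xStep c pick s₁) ⟨1, s₂⟩

open Classical in
/-- The loop that lifts the estimate on `Γ` with support `Ω`, over the list `vertices` of all
vertices: the estimate is multiplied by the product of `Z_q` over `q ∈ lift v`. -/
noncomputable def zPhase (vertices : List Γ.Vertex) (lift : Γ.Vertex → Set D)
    (Ω : Set Γ.Vertex) (est : Pauli D) : Pauli D :=
  vertices.foldl (fun e v => if v ∈ Ω then e * onSet Letter.Z (lift v) else e) est

/-- The decoding algorithm: correct the `X` errors face by face, decode the updated rank-3
syndromes with the decoder `dec` of the color code on `Γ`, and lift the result. -/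
noncomputable def decode (c : Γ.RankTwoColoring) (faces : List Γ.Face) (vertices : List Γ.Vertex)
    (pick : Γ.Face → D) (lift : Γ.Vertex → Set D)
    (dec : (Γ.Face → ZMod 2) → Pauli Γ.Vertex) (s₁ s₂ : Γ.Face → ZMod 2) : Pauli D :=
  let st := xPhase c faces pick s₁ s₂
  zPhase vertices lift (dec st.syn).support st.est

end TwoColex

/-! Modulo phases a Pauli operator is a pair of binary vectors and a syndrome is their symplectic
form, so everything reduces to linear algebra over `ZMod 2`.

Errors to `Z`-type: the `X` parts of the link operators are the pairs of consecutive corners of a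
face, and these span the vectors of even weight on every face. Hence an error with trivial rank-2
syndromes is a `Z`-type error modulo the gauge group (`exists_mem_vectors_of_even`).

Syndromes: `W₂ c f` commutes with the gauge group, and its `X` part is the indicator of the
triangles around `f`. Since the pullback of functions from vertices to qubits is adjoint to
summation over triangles, `W₂ c f` measures on a `Z`-type error what `B_f^X` measures on its
projection.

Equivalence: a product of links with zero `X` part has coefficients constant around each face, so it
is a product of operators `W₁`. These project to the `B_f^Z`, because a face has at most one corner
at a vertex, while the kernel of the projection is spanned by the gauge generators `Z_u Z_v`. Thus a
`Z`-type operator is a gauge operator exactly if its projection lies in the color code stabilizer,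
up to phases (`mem_vectors_gaugeGroup_iff`).

Arbitrary stabilizers: no generating set is needed. An element of `G ∩ C(G)` has as `X` part the
pullback of a sum of faces (`exists_face_of_mem_stabilizer`), so it commutes with every `Z`-type
error whose projection has trivial syndrome. The estimate differs from the error by such an
operator, modulo the gauge group. -/

theorem add_self_eq_zero_of_binary {D : Type*} (y : D → ZMod 2) : y + y = 0 :=
  funext fun _ => CharTwo.add_self_eq_zero _

/-! ### Pauli operators as binary vectors -/

namespace Pauli

variable {Q : Type*}

open Classical in
theorem indicator_pair {s : Set Q} {u v : Q} (h : u ≠ v) (hs : s = {u, v}) :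
    (fun q => if q ∈ s then (1 : ZMod 2) else 0) = Pi.single u 1 + Pi.single v 1 := by
  subst hs
  funext q
  by_cases h1 : q = u <;> by_cases h2 : q = v <;> simp_all

variable [Fintype Q]

theorem signPhase_injective : Function.Injective signPhase := by
  intro s t; revert s t; decide

@[simp] theorem mul_x (g h : Pauli Q) : (g * h).x = g.x + h.x := rfl

@[simp] theorem mul_z (g h : Pauli Q) : (g * h).z = g.z + h.z := rfl

@[simp] theorem inv_x (g : Pauli Q) : g⁻¹.x = g.x := rfl

@[simp] theorem inv_z (g : Pauli Q) : g⁻¹.z = g.z := rfl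

/-- The syndrome is the symplectic form of the binary vectors of the two operators. -/
theorem syndrome_eq (g e : Pauli Q) : syndrome g e = g.x ⬝ᵥ e.z + g.z ⬝ᵥ e.x := by
  have key : ∀ s t : ZMod 2, s ≠ t → 1 = t + s := by decide
  have hcomm : g * e = e * g ↔ g.z ⬝ᵥ e.x = e.z ⬝ᵥ g.x := by
    simp only [mul_def, Pauli.mk.injEq]
    constructor
    · rintro ⟨h, -, -⟩
      apply signPhase_injective
      rw [add_comm e.phase] at h
      exact add_left_cancel h
    · intro h
      rw [h]
      exact ⟨by abel, by abel, by abel⟩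
  unfold syndrome
  rw [dotProduct_comm g.x]
  split_ifs with h
  · rw [hcomm.1 h, CharTwo.add_self_eq_zero]
  · exact key _ _ fun h' => h (hcomm.2 h')

theorem syndrome_mul_right (g e e' : Pauli Q) :
    syndrome g (e * e') = syndrome g e + syndrome g e' := by
  simp only [syndrome_eq, mul_x, mul_z, dotProduct_add]
  abel

theorem syndrome_inv_right (g e : Pauli Q) : syndrome g e⁻¹ = syndrome g e := by
  simp only [syndrome_eq, inv_x, inv_z]

theorem syndrome_one_right (g : Pauli Q) : syndrome g 1 = 0 := by
  simp [syndrome_eq, one_def]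

theorem syndrome_eq_zero_of_comm {g e : Pauli Q} (h : g * e = e * g) : syndrome g e = 0 := by
  simp [syndrome, h]

/-- The binary vectors of the elements of a group of Pauli operators. -/
def vectors (H : Subgroup (Pauli Q)) : AddSubgroup ((Q → ZMod 2) × (Q → ZMod 2)) where
  carrier := {p | ∃ h ∈ H, h.x = p.1 ∧ h.z = p.2}
  zero_mem' := ⟨1, H.one_mem, rfl, rfl⟩
  add_mem' := by
    rintro _ _ ⟨g, hg, hx, hz⟩ ⟨h, hh, hx', hz'⟩
    exact ⟨g * h, H.mul_mem hg hh, by simp [hx, hx'], by simp [hz, hz']⟩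
  neg_mem' := by
    rintro _ ⟨g, hg, hx, hz⟩
    refine ⟨g, hg, ?_, ?_⟩
    · rw [hx]; funext q; simp
    · rw [hz]; funext q; simp

theorem vectors_mem_of_mem {H : Subgroup (Pauli Q)} {g : Pauli Q} (hg : g ∈ H) :
    (g.x, g.z) ∈ vectors H := ⟨g, hg, rfl, rfl⟩

theorem smul_mem_vectors {H : Subgroup (Pauli Q)} {p : (Q → ZMod 2) × (Q → ZMod 2)}
    (s : ZMod 2) (hp : p ∈ vectors H) : s • p ∈ vectors H := by
  have : s = 0 ∨ s = 1 := by revert s; decide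
  rcases this with rfl | rfl
  · rw [zero_smul]; exact zero_mem _
  · rwa [one_smul]

/-- Scalars have zero binary vector, and operators with equal vectors differ by a scalar. This turns
equivalence modulo a group into membership in an additive group. -/
theorem mem_withPhases_iff {H : Subgroup (Pauli Q)} {g : Pauli Q} :
    g ∈ withPhases H ↔ (g.x, g.z) ∈ vectors H := by
  constructor
  · intro hg
    let K : Subgroup (Pauli Q) :=
      { carrier := {g | (g.x, g.z) ∈ vectors H}
        one_mem' := zero_mem (vectors H)
        mul_mem' := fun ha hb => (vectors H).add_mem ha hb
        inv_mem' := fun ha => ha }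
    have hK : withPhases H ≤ K := by
      refine sup_le ((Subgroup.closure_le _).2 ?_) fun h hh => vectors_mem_of_mem hh
      rintro _ ⟨k, rfl⟩
      exact zero_mem (vectors H)
    exact hK hg
  · rintro ⟨h, hh, hx, hz⟩
    have : g = scalar Q (g.phase - h.phase) * h := by
      ext1
      · simp [scalar, mul_def, signPhase]
      · exact (hx.symm).trans (zero_add _).symm
      · exact (hz.symm).trans (zero_add _).symm
    rw [this]
    exact mul_mem (Subgroup.mem_sup_left (Subgroup.subset_closure ⟨_, rfl⟩))
      (Subgroup.mem_sup_right hh)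

theorem equivMod_iff {H : Subgroup (Pauli Q)} {g h : Pauli Q} :
    EquivMod H g h ↔ (g.x + h.x, g.z + h.z) ∈ vectors H := mem_withPhases_iff

open Classical in
theorem onSet_X_x (s : Set Q) (q : Q) : (onSet Letter.X s).x q = if q ∈ s then 1 else 0 := by
  simp only [onSet, tensor]; split_ifs <;> rfl

theorem onSet_X_z (s : Set Q) : (onSet Letter.X s).z = 0 := by
  funext q
  simp only [onSet, tensor]; split_ifs <;> rfl

open Classical in
theorem onSet_Z_z (s : Set Q) (q : Q) : (onSet Letter.Z s).z q = if q ∈ s then 1 else 0 := by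
  simp only [onSet, tensor]; split_ifs <;> rfl

theorem onSet_Z_x (s : Set Q) : (onSet Letter.Z s).x = 0 := by
  funext q
  simp only [onSet, tensor]; split_ifs <;> rfl

open Classical in
theorem onSet_Y_x (s : Set Q) (q : Q) : (onSet Letter.Y s).x q = if q ∈ s then 1 else 0 := by
  simp only [onSet, tensor]; split_ifs <;> rfl

open Classical in
theorem onSet_Y_z (s : Set Q) (q : Q) : (onSet Letter.Y s).z q = if q ∈ s then 1 else 0 := by
  simp only [onSet, tensor]; split_ifs <;> rfl

theorem syndrome_onSet_X_singleton (g : Pauli Q) (q : Q) :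
    syndrome g (onSet Letter.X {q}) = g.z q := by
  classical
  rw [syndrome_eq, onSet_X_z, dotProduct_zero, zero_add]
  simp [dotProduct, onSet_X_x]

end Pauli

/-- A binary vector with even weight on all fibers of `p` is a sum of pairs inside fibers. -/
theorem AddSubgroup.mem_of_fiber_sum_eq_zero {D B : Type*} [Fintype D] [DecidableEq D]
    [DecidableEq B] (p : D → B)
    (A : AddSubgroup (D → ZMod 2))
    (hA : ∀ u v, p u = p v → Pi.single u 1 + Pi.single v 1 ∈ A)
    (z : D → ZMod 2) (hz : ∀ b, ∑ q with p q = b, z q = 0) : z ∈ A := by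
  classical
  -- Each point is paired with a fixed representative of its fiber. The representatives cancel in
  -- total because every fiber has even weight.
  let rep : D → D := fun q => Set.rangeSplitting p ⟨p q, Set.mem_range_self q⟩
  have hp : ∀ q, p (rep q) = p q := fun q => Set.apply_rangeSplitting p _
  have hrep : ∀ q q', p q = p q' → rep q = rep q' := fun q q' h => by simp only [rep, h]
  have h0 : ∑ q, z q • (Pi.single (rep q) 1 : D → ZMod 2) = 0 := by
    rw [← Finset.sum_fiberwise_of_maps_to (t := Finset.univ.image p) (g := p)
      (fun q _ => Finset.mem_image_of_mem p (Finset.mem_univ q))]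
    refine Finset.sum_eq_zero fun b hb => ?_
    obtain ⟨d, -, rfl⟩ := Finset.mem_image.1 hb
    rw [Finset.sum_congr rfl (g := fun q => z q • (Pi.single (rep d) 1 : D → ZMod 2)),
      ← Finset.sum_smul, hz, zero_smul]
    intro q hq
    rw [hrep q d (Finset.mem_filter.1 hq).2]
  have h1 : z = ∑ q, z q • (Pi.single q 1 + Pi.single (rep q) 1 : D → ZMod 2) := by
    simp only [smul_add, Finset.sum_add_distrib]
    rw [h0, add_zero]
    funext d
    simp [Pi.single_apply]
  rw [h1]
  refine sum_mem fun q _ => ?_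
  have : z q = 0 ∨ z q = 1 := by generalize z q = s; revert s; decide
  rcases this with h | h <;> rw [h]
  · rw [zero_smul]; exact zero_mem _
  · rw [one_smul]; exact hA _ _ (hp q).symm

/-! ### Darts, vertices and faces of a cubic map -/

namespace CubicMap

variable {D : Type*} (Γ : CubicMap D)

theorem along_apply (d : D) : Γ.along d = Γ.next.symm (Γ.rev d) := rfl

theorem along_symm_apply (d : D) : Γ.along.symm d = Γ.rev (Γ.next d) := by
  rw [Equiv.symm_apply_eq, along_apply, Γ.rev_rev, Equiv.symm_apply_apply]

theorem next_symm_apply (d : D) : Γ.next.symm d = Γ.next (Γ.next d) := by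
  rw [Equiv.symm_apply_eq, Γ.next_next_next]

theorem vertex_eq_iff_sameCycle {p q : D} : Γ.vertex p = Γ.vertex q ↔ Γ.next.SameCycle p q :=
  Quotient.eq

theorem face_eq_iff_sameCycle {p q : D} : Γ.face p = Γ.face q ↔ Γ.along.SameCycle p q :=
  Quotient.eq

theorem vertex_next (d : D) : Γ.vertex (Γ.next d) = Γ.vertex d :=
  Γ.vertex_eq_iff_sameCycle.2 (Equiv.Perm.sameCycle_apply_left.2 (Equiv.Perm.SameCycle.refl _ _))

theorem face_along (d : D) : Γ.face (Γ.along d) = Γ.face d :=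
  Γ.face_eq_iff_sameCycle.2 (Equiv.Perm.sameCycle_apply_left.2 (Equiv.Perm.SameCycle.refl _ _))

theorem face_along_symm (d : D) : Γ.face (Γ.along.symm d) = Γ.face d := by
  rw [← Γ.face_along, Equiv.apply_symm_apply]

theorem face_rev_next (d : D) : Γ.face (Γ.rev (Γ.next d)) = Γ.face d := by
  rw [← along_symm_apply, face_along_symm]

/-- The face on the right of `d`. -/
theorem face_rev (d : D) : Γ.face (Γ.rev d) = Γ.face (Γ.next.symm d) := by
  rw [← face_rev_next Γ (Γ.next.symm d), Equiv.apply_symm_apply]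

theorem vertex_eq_iff {p q : D} :
    Γ.vertex q = Γ.vertex p ↔ q = p ∨ q = Γ.next p ∨ q = Γ.next.symm p := by
  constructor
  · intro h
    obtain ⟨k, rfl⟩ := Γ.vertex_eq_iff_sameCycle.1 h.symm
    have h3 : Γ.next ^ (3 : ℤ) = 1 := by
      ext d
      exact Γ.next_next_next d
    have hk : k = 3 * (k / 3) + k % 3 := (Int.mul_ediv_add_emod k 3).symm
    rw [hk, zpow_add, zpow_mul, h3, one_zpow, one_mul, next_symm_apply]
    have : k % 3 = 0 ∨ k % 3 = 1 ∨ k % 3 = 2 := by omega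
    rcases this with h | h | h <;> rw [h]
    · exact Or.inl rfl
    · exact Or.inr (Or.inl rfl)
    · exact Or.inr (Or.inr rfl)
  · rintro (rfl | rfl | rfl)
    · rfl
    · exact Γ.vertex_next p
    · rw [← Γ.vertex_next, Equiv.apply_symm_apply]

instance [Finite D] : Finite Γ.Face := by unfold Face; infer_instance

end CubicMap

/-! ### The three distinct faces at a vertex -/

namespace TwoColex

open Pauli

section Colex

variable {D : Type*} (Γ : TwoColex D)

/-- The only use of the face coloring. It makes the three faces at every vertex pairwise distinct.
-/
theorem face_ne_face_rev (d : D) : Γ.face d ≠ Γ.face (Γ.rev d) := by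
  obtain ⟨color, h⟩ := Γ.colorable
  exact fun h' => h d (congrArg color h')

theorem face_next_ne (d : D) : Γ.face (Γ.next d) ≠ Γ.face d := by
  rw [← Γ.face_rev_next d]
  exact Γ.face_ne_face_rev _

theorem face_next_symm_ne (d : D) : Γ.face (Γ.next.symm d) ≠ Γ.face d := by
  have := Γ.face_next_ne (Γ.next.symm d)
  rwa [Equiv.apply_symm_apply, ne_comm] at this

theorem face_next_symm_ne_face_next (d : D) : Γ.face (Γ.next.symm d) ≠ Γ.face (Γ.next d) := by
  rw [Γ.next_symm_apply]
  exact Γ.face_next_ne _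

/-- Every face meets a vertex in at most one corner. -/
theorem eq_of_vertex_eq_of_face_eq {p q : D} (hv : Γ.vertex q = Γ.vertex p)
    (hf : Γ.face q = Γ.face p) : q = p := by
  rcases Γ.vertex_eq_iff.1 hv with rfl | rfl | rfl
  · rfl
  · exact absurd hf (Γ.face_next_ne p)
  · exact absurd hf (Γ.face_next_symm_ne p)

theorem onFace_vertex_iff (q : D) (f : Γ.Face) : Γ.OnFace (Γ.vertex q) f ↔
    Γ.face q = f ∨ Γ.face (Γ.next.symm q) = f ∨ Γ.face (Γ.next q) = f := by
  constructor
  · rintro ⟨d, hv, rfl⟩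
    rcases Γ.vertex_eq_iff.1 hv with rfl | rfl | rfl <;> simp
  · rintro (h | h | h)
    · exact ⟨q, rfl, h⟩
    · exact ⟨_, Γ.vertex_eq_iff.2 (Or.inr (Or.inr rfl)), h⟩
    · exact ⟨_, Γ.vertex_next q, h⟩

theorem adjacent_face_next (q : D) : Γ.Adjacent (Γ.face q) (Γ.face (Γ.next q)) :=
  ⟨Γ.rev (Γ.next q), Γ.face_rev_next q, by rw [Γ.rev_rev]⟩

theorem adjacent_face_next_symm (q : D) : Γ.Adjacent (Γ.face q) (Γ.face (Γ.next.symm q)) :=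
  ⟨q, rfl, Γ.face_rev q⟩

theorem ne_of_adjacent {f g : Γ.Face} (h : Γ.Adjacent f g) : g ≠ f := by
  obtain ⟨d, rfl, rfl⟩ := h
  exact (Γ.face_ne_face_rev d).symm

end Colex

/-! ### Summation over triangles and the projection to the color code -/

section VertexSum

variable {D : Type*} [Fintype D] (Γ : TwoColex D)

open Classical in
/-- The sums of `z` over the triangles: the `Z` part of the projection of an operator with
`Z` part `z`. -/
noncomputable def vertexSum (z : D → ZMod 2) (v : Γ.Vertex) : ZMod 2 :=
  ∑ q with Γ.vertex q = v, z q

theorem proj_z (e : Pauli D) : (Γ.proj e).z = Γ.vertexSum e.z := rfl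

theorem vertexSum_add (z w : D → ZMod 2) :
    Γ.vertexSum (z + w) = Γ.vertexSum z + Γ.vertexSum w := by
  funext v
  simp [vertexSum, Finset.sum_add_distrib]

theorem vertexSum_zero : Γ.vertexSum 0 = 0 := by
  funext v
  simp [vertexSum]

/-- The projection is adjoint to the map that sends `Z_v` to the product of `Z_q` over the triangle
of `v`. -/
theorem vertexSum_dotProduct (z : D → ZMod 2) (y : Γ.Vertex → ZMod 2) :
    Γ.vertexSum z ⬝ᵥ y = z ⬝ᵥ fun q => y (Γ.vertex q) := by
  classical
  simp only [dotProduct, vertexSum, Finset.sum_mul]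
  rw [← Finset.sum_fiberwise (s := Finset.univ) (g := Γ.vertex)]
  refine Finset.sum_congr rfl fun v _ => Finset.sum_congr ?_ fun q hq => ?_
  · ext; simp
  · rw [(Finset.mem_filter.1 hq).2]

theorem vertexSum_vertex (q : D) (z : D → ZMod 2) :
    Γ.vertexSum z (Γ.vertex q) = z q + z (Γ.next q) + z (Γ.next.symm q) := by
  classical
  have h1 : q ≠ Γ.next q := (Γ.next_ne q).symm
  have h2 : q ≠ Γ.next.symm q := fun h => Γ.next_ne q ((Γ.next.eq_symm_apply).1 h)
  have h3 : Γ.next q ≠ Γ.next.symm q := by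
    rw [Γ.next_symm_apply]; exact (Γ.next_ne _).symm
  have : (Finset.univ.filter fun p => Γ.vertex p = Γ.vertex q)
      = {q, Γ.next q, Γ.next.symm q} := by
    ext p
    simp [Γ.vertex_eq_iff]
  unfold vertexSum
  rw [Finset.sum_congr (s₂ := {q, Γ.next q, Γ.next.symm q}) (by rw [← this])
    fun _ _ => rfl, Finset.sum_insert (by simp [h1, h2]), Finset.sum_insert (by simp [h3]),
    Finset.sum_singleton, add_assoc]

/-- A function of the vertex is multiplied by `3 = 1`. -/
theorem vertexSum_comp_vertex (y : Γ.Vertex → ZMod 2) :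
    Γ.vertexSum (fun q => y (Γ.vertex q)) = y := by
  funext v
  obtain ⟨q, rfl⟩ : ∃ q, Γ.vertex q = v := Quotient.exists_rep v
  have : Γ.vertex (Γ.next.symm q) = Γ.vertex q := Γ.vertex_eq_iff.2 (Or.inr (Or.inr rfl))
  rw [vertexSum_vertex, Γ.vertex_next, this, CharTwo.add_self_eq_zero, zero_add]

open Classical in
theorem vertexSum_face (f : Γ.Face) (v : Γ.Vertex) :
    Γ.vertexSum (fun q => if Γ.face q = f then 1 else 0) v = if Γ.OnFace v f then 1 else 0 := by
  unfold vertexSum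
  split_ifs with h
  · obtain ⟨d, rfl, rfl⟩ := h
    rw [Finset.sum_eq_single d]
    · simp
    · intro q hq hne
      exact if_neg fun h => hne (Γ.eq_of_vertex_eq_of_face_eq (Finset.mem_filter.1 hq).2 h)
    · intro h
      exact absurd (by simp) h
  · refine Finset.sum_eq_zero fun q hq => if_neg fun hf => h ⟨q, (Finset.mem_filter.1 hq).2, hf⟩

open Classical in
theorem vertexSum_single (q : D) (v : Γ.Vertex) :
    Γ.vertexSum (Pi.single q 1) v = if Γ.vertex q = v then 1 else 0 := by
  simp only [vertexSum, Finset.sum_pi_single', Finset.mem_filter, Finset.mem_univ, true_and]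

open Classical in
theorem vertexSum_singleton (q : D) (v : Γ.Vertex) :
    Γ.vertexSum (onSet Letter.Z {q}).z v = if Γ.vertex q = v then 1 else 0 := by
  have : (onSet Letter.Z {q}).z = Pi.single q 1 := by
    funext p
    simp [onSet_Z_z, Pi.single_apply]
  rw [this, vertexSum_single]

open Classical in
theorem vertexSum_triangle (v w : Γ.Vertex) :
    Γ.vertexSum (onSet Letter.Z (Γ.triangle v)).z w = if v = w then 1 else 0 := by
  have : (onSet Letter.Z (Γ.triangle v)).z
      = fun q => (fun w => if v = w then 1 else 0) (Γ.vertex q) := by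
    funext q
    simp [onSet_Z_z, triangle, eq_comm]
  rw [this]
  exact congrFun (Γ.vertexSum_comp_vertex fun w => if v = w then 1 else 0) w

end VertexSum

end TwoColex

/-! ### Alternating colorings of the rank-2 edges -/

namespace TwoColex

open Pauli

variable {D : Type*} {Γ : TwoColex D}

namespace RankTwoColoring

variable (c : Γ.RankTwoColoring)

theorem red_along (d : D) : c.red (Γ.along d) ↔ ¬ c.red d := by
  have := c.alt_corner (Γ.along d)
  rw [Equiv.symm_apply_apply] at this
  tauto

-- Colors alternate around a face, so no face has a single corner; hence every link operator acts on
-- two distinct qubits.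
include c in
theorem along_ne (d : D) : Γ.along d ≠ d := fun h => by
  have := c.red_along d
  rw [h] at this
  tauto

end RankTwoColoring

/-! ### Products of link operators -/

variable (Γ) in
/-- The `X` part of the product of the link operators `d` with `L d = 1`. -/
def linkX (L : D → ZMod 2) (p : D) : ZMod 2 := L p + L (Γ.along.symm p)

open Classical in
/-- The `Z` part of the product of the link operators `d` with `L d = 1`. -/
noncomputable def linkZ (c : Γ.RankTwoColoring) (L : D → ZMod 2) (p : D) : ZMod 2 :=
  if c.red p then L (Γ.along.symm p) else L p

variable (c : Γ.RankTwoColoring)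

theorem linkX_add (L M : D → ZMod 2) : Γ.linkX (L + M) = Γ.linkX L + Γ.linkX M := by
  funext p
  simp only [linkX, Pi.add_apply]
  abel

theorem linkZ_add (L M : D → ZMod 2) : linkZ c (L + M) = linkZ c L + linkZ c M := by
  funext p
  simp only [linkZ, Pi.add_apply]
  split_ifs <;> rfl

theorem linkX_zero : Γ.linkX 0 = 0 := by
  funext p
  simp [linkX]

theorem linkZ_zero : linkZ c 0 = 0 := by
  funext p
  simp [linkZ]

variable [Fintype D]

open Classical in
theorem linkOp_x (d : D) : (linkOp c d).x = Pi.single d 1 + Pi.single (Γ.along d) 1 := by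
  rw [← indicator_pair (c.along_ne d).symm rfl]
  unfold linkOp
  split_ifs
  · exact funext (onSet_X_x _)
  · exact funext (onSet_Y_x _)

open Classical in
theorem linkOp_z (d : D) : (linkOp c d).z
    = if c.red d then 0 else Pi.single d 1 + Pi.single (Γ.along d) 1 := by
  rw [← indicator_pair (c.along_ne d).symm rfl]
  unfold linkOp
  split_ifs
  · exact onSet_X_z _
  · exact funext fun p => onSet_Y_z _ p

open Classical in
theorem linkOp_x_eq_linkX (d : D) : (linkOp c d).x = Γ.linkX (Pi.single d 1) := by
  funext p
  simp [linkOp_x, linkX, Pi.single_apply, Equiv.symm_apply_eq]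

-- The links at the corner `p` are `p` and `along⁻¹ p`, one red and one green. Only the green one
-- contributes to the `Z` part, which is what `linkZ` selects.
open Classical in
theorem linkOp_z_eq_linkZ (d : D) : (linkOp c d).z = linkZ c (Pi.single d 1) := by
  funext p
  rw [linkOp_z]
  simp only [linkZ, Pi.single_apply, Equiv.symm_apply_eq]
  by_cases hp : p = d
  · subst hp
    by_cases h : c.red p <;> simp [h, (c.along_ne p).symm]
  · by_cases hp' : p = Γ.along d
    · subst hp'
      have := c.red_along d
      by_cases h : c.red d <;> simp [h, this, c.along_ne d]
    · split_ifs <;> simp [hp, hp']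

open Classical in
theorem pairZ_z {u v : D} (h : u ≠ v) :
    (onSet Letter.Z {u, v}).z = Pi.single u 1 + Pi.single v 1 := by
  rw [← indicator_pair h rfl]
  exact funext fun p => onSet_Z_z _ p

theorem linkOp_mem_gaugeGroup (d : D) : linkOp c d ∈ gaugeGroup c :=
  Subgroup.subset_closure (Or.inl ⟨d, rfl⟩)

theorem pairZ_mem_gaugeGroup {u v : D} (h : u ≠ v) (hv : Γ.vertex u = Γ.vertex v) :
    onSet Letter.Z {u, v} ∈ gaugeGroup c :=
  Subgroup.subset_closure (Or.inr ⟨u, v, h, hv, rfl⟩)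

theorem links_mem_vectors (L : D → ZMod 2) :
    (Γ.linkX L, linkZ c L) ∈ vectors (gaugeGroup c) := by
  classical
  have hL : L = ∑ d, L d • (Pi.single d 1 : D → ZMod 2) := by
    funext p
    simp [Pi.single_apply]
  let fX : (D → ZMod 2) →+ (D → ZMod 2) := ⟨⟨Γ.linkX, linkX_zero⟩, linkX_add⟩
  let fZ : (D → ZMod 2) →+ (D → ZMod 2) := ⟨⟨linkZ c, linkZ_zero c⟩, linkZ_add c⟩
  change (fX.prod fZ) L ∈ _
  rw [hL, map_sum]
  refine sum_mem fun d _ => ?_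
  -- Writing the coefficient as a natural multiple makes additivity of `fX` and `fZ` sufficient.
  rw [← ZMod.natCast_zmod_val (L d), Nat.cast_smul_eq_nsmul, map_nsmul]
  refine nsmul_mem ?_ _
  have := vectors_mem_of_mem (linkOp_mem_gaugeGroup c d)
  rwa [linkOp_x_eq_linkX, linkOp_z_eq_linkZ] at this

/-- Modulo pairs of `Z` on the rank-3 edges, gauge operators are products of link operators. -/
theorem exists_links {g : Pauli D} (hg : g ∈ gaugeGroup c) :
    ∃ L, g.x = Γ.linkX L ∧ Γ.vertexSum g.z = Γ.vertexSum (linkZ c L) := by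
  classical
  induction hg using Subgroup.closure_induction with
  | mem g hg =>
    rcases hg with ⟨d, rfl⟩ | ⟨u, v, hne, hv, rfl⟩
    · exact ⟨Pi.single d 1, linkOp_x_eq_linkX c d, by rw [linkOp_z_eq_linkZ]⟩
    · refine ⟨0, by rw [onSet_Z_x, linkX_zero], ?_⟩
      rw [linkZ_zero, vertexSum_zero, pairZ_z hne, vertexSum_add]
      funext w
      simp only [Pi.add_apply, vertexSum_single, hv, Pi.zero_apply]
      exact CharTwo.add_self_eq_zero _
  | one => exact ⟨0, linkX_zero.symm, by rw [linkZ_zero]; rfl⟩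
  | mul g h _ _ ihg ihh =>
    obtain ⟨L, hx, hz⟩ := ihg
    obtain ⟨M, hx', hz'⟩ := ihh
    exact ⟨L + M, by rw [mul_x, hx, hx', linkX_add],
      by rw [mul_z, vertexSum_add, hz, hz', linkZ_add, vertexSum_add]⟩
  | inv g _ ih => exact ih

theorem exists_links_of_mem_vectors {p : (D → ZMod 2) × (D → ZMod 2)}
    (hp : p ∈ vectors (gaugeGroup c)) :
    ∃ L, p.1 = Γ.linkX L ∧ Γ.vertexSum p.2 = Γ.vertexSum (linkZ c L) := by
  obtain ⟨g, hg, hx, hz⟩ := hp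
  rw [← hx, ← hz]
  exact exists_links c hg

/-- The rank-2 stabilizers are products of link operators. -/
theorem face_mem_vectors (m : Γ.Face → ZMod 2) :
    ((0, fun q => m (Γ.face q)) : (D → ZMod 2) × (D → ZMod 2)) ∈ vectors (gaugeGroup c) := by
  have h := links_mem_vectors c fun q => m (Γ.face q)
  have hx : Γ.linkX (fun q => m (Γ.face q)) = 0 := by
    funext p
    simp only [linkX, Γ.face_along_symm]
    exact CharTwo.add_self_eq_zero _
  have hz : linkZ c (fun q => m (Γ.face q)) = fun q => m (Γ.face q) := by
    funext p
    simp only [linkZ, Γ.face_along_symm, ite_self]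
  rwa [hx, hz] at h

/-- Even weight on every triangle means a sum of pairs inside triangles, and these pairs are gauge
generators. -/
theorem mem_vectors_of_vertexSum_eq_zero {z : D → ZMod 2} (hz : Γ.vertexSum z = 0) :
    ((0, z) : (D → ZMod 2) × (D → ZMod 2)) ∈ vectors (gaugeGroup c) := by
  classical
  refine AddSubgroup.mem_of_fiber_sum_eq_zero Γ.vertex
    ((vectors (gaugeGroup c)).comap (AddMonoidHom.inr (D → ZMod 2) (D → ZMod 2))) ?_ z ?_
  · intro u v huv
    by_cases h : u = v
    · subst h
      rw [add_self_eq_zero_of_binary]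
      exact zero_mem _
    · rw [← pairZ_z h]
      exact ⟨_, pairZ_mem_gaugeGroup c h huv, onSet_Z_x _, rfl⟩
  · intro v
    have h : Γ.vertexSum z v = 0 := congrFun hz v
    exact (Finset.sum_congr (by ext; simp) fun _ _ => rfl).trans h

/-- An operator with even `X` weight on every face is equivalent to a `Z`-type operator. -/
theorem exists_mem_vectors_of_even {x : D → ZMod 2}
    (hx : ∀ f, syndrome (Γ.W₁ f) ⟨0, x, 0⟩ = 0) :
    ∃ z, (x, z) ∈ vectors (gaugeGroup c) := by
  classical
  have key : x ∈ (vectors (gaugeGroup c)).map (AddMonoidHom.fst _ _) := by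
    refine AddSubgroup.mem_of_fiber_sum_eq_zero Γ.face _ ?_ x ?_
    · intro u v huv
      -- Two corners of a face are joined by a path of rank-2 edges, along which the `X` parts of
      -- the link operators telescope to the two ends.
      obtain ⟨k, -, rfl⟩ := (Γ.face_eq_iff_sameCycle.1 huv).exists_pow_eq'
      clear huv
      induction k with
      | zero =>
        rw [pow_zero, Equiv.Perm.one_apply, add_self_eq_zero_of_binary]
        exact zero_mem _
      | succ k ih =>
        have h1 : (linkOp c ((Γ.along ^ k) u)).x
            ∈ (vectors (gaugeGroup c)).map (AddMonoidHom.fst _ _) :=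
          ⟨_, vectors_mem_of_mem (linkOp_mem_gaugeGroup c _), rfl⟩
        convert add_mem ih h1 using 1
        rw [linkOp_x, pow_succ', Equiv.Perm.mul_apply]
        rw [add_assoc, ← add_assoc (Pi.single ((Γ.along ^ k) u) 1), add_self_eq_zero_of_binary,
          zero_add]
    · intro f
      have := hx f
      rw [syndrome_eq, W₁, onSet_Z_x, zero_dotProduct, zero_add] at this
      refine Eq.trans ?_ this
      simp [dotProduct, onSet_Z_z, Finset.sum_filter]
  obtain ⟨⟨x', z⟩, h, rfl⟩ := key
  exact ⟨z, h⟩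

/-! ### Syndromes of gauge operators -/

theorem syndrome_linkOp (g : Pauli D) (d : D) [Decidable (c.red d)] :
    syndrome g (linkOp c d)
      = (if c.red d then 0 else g.x d + g.x (Γ.along d)) + (g.z d + g.z (Γ.along d)) := by
  classical
  rw [syndrome_eq, linkOp_x, linkOp_z]
  split_ifs <;> simp [dotProduct_add]

theorem syndrome_pairZ (g : Pauli D) {u v : D} (h : u ≠ v) :
    syndrome g (onSet Letter.Z {u, v}) = g.x u + g.x v := by
  classical
  rw [syndrome_eq, onSet_Z_x, pairZ_z h]
  simp [dotProduct_add]

theorem syndrome_gauge_eq_zero {g : Pauli D}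
    (hlink : ∀ d, syndrome g (linkOp c d) = 0)
    (hpair : ∀ u v, Γ.vertex u = Γ.vertex v → g.x u = g.x v)
    {h : Pauli D} (hh : h ∈ gaugeGroup c) : syndrome g h = 0 := by
  induction hh using Subgroup.closure_induction with
  | mem h hh =>
    rcases hh with ⟨d, rfl⟩ | ⟨u, v, hne, hv, rfl⟩
    · exact hlink d
    · rw [syndrome_pairZ g hne, hpair u v hv, CharTwo.add_self_eq_zero]
  | one => exact syndrome_one_right g
  | mul a b _ _ ha hb => rw [syndrome_mul_right, ha, hb, add_zero]
  | inv a _ ha => rw [syndrome_inv_right, ha]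

/-- Operators that commute with the gauge group do not distinguish equivalent errors. -/
theorem syndrome_eq_of_mem_vectors {g e e' : Pauli D}
    (hg : ∀ h ∈ gaugeGroup c, syndrome g h = 0)
    (h : (e.x + e'.x, e.z + e'.z) ∈ vectors (gaugeGroup c)) : syndrome g e = syndrome g e' := by
  obtain ⟨k, hk, hx, hz⟩ := h
  have h0 := hg k hk
  rw [syndrome_eq, hx, hz, dotProduct_add, dotProduct_add] at h0
  rw [syndrome_eq, syndrome_eq, ← CharTwo.add_eq_zero, ← h0]
  abel

end TwoColex

namespace TwoColex

open Pauli

variable {D : Type*} [Fintype D] {Γ : TwoColex D} (c : Γ.RankTwoColoring)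

/-! ### The rank-3 stabilizers -/

-- `X` and `Y` have the same `X` bit, so the coloring drops out and the `X` part is constant on
-- triangles.
open Classical in
theorem W₂_x (f : Γ.Face) (q : D) :
    (W₂ c f).x q = if Γ.OnFace (Γ.vertex q) f then 1 else 0 := by
  simp only [Γ.onFace_vertex_iff, W₂, tensor]
  split_ifs <;> first | rfl | (exfalso; tauto)

open Classical in
theorem W₂_z (f : Γ.Face) (q : D) :
    (W₂ c f).z q = if Γ.face q = f then 1
      else if Γ.face (Γ.next.symm q) = f then if c.red q then 1 else 0
      else if Γ.face (Γ.next q) = f then if c.red q then 0 else 1 else 0 := by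
  simp only [W₂, tensor, c.alt_corner]
  split_ifs <;> rfl

/-- If `f` contains the link, `W₂ c f` acts as `YY` on it. If `f` lies across the split edge, it
acts by the same letter at both ends (`h2`: both ends see that face). If `f` is the third face at an
end, it acts there by the letter of the link itself. Each case commutes with the link operator. -/
theorem syndrome_W₂_linkOp (f : Γ.Face) (d : D) : syndrome (W₂ c f) (linkOp c d) = 0 := by
  classical
  have h2 : Γ.face (Γ.next (Γ.along d)) = Γ.face (Γ.next.symm d) := by
    rw [Γ.along_apply, Equiv.apply_symm_apply, Γ.face_rev]
  have h3 := Γ.face_next_ne d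
  have h4 := Γ.face_next_symm_ne d
  have h5 := Γ.face_next_symm_ne_face_next d
  have h6 := Γ.face_next_symm_ne (Γ.along d)
  have h7 := Γ.face_next_symm_ne_face_next (Γ.along d)
  rw [Γ.face_along] at h6
  rw [h2] at h7
  simp only [syndrome_linkOp, W₂_x, W₂_z, Γ.onFace_vertex_iff, Γ.face_along, h2, c.red_along]
  by_cases hr : c.red d <;> by_cases e1 : Γ.face d = f <;>
    by_cases e2 : Γ.face (Γ.next.symm d) = f <;> by_cases e3 : Γ.face (Γ.next d) = f <;>
    by_cases e4 : Γ.face (Γ.next.symm (Γ.along d)) = f <;>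
    simp_all [CharTwo.add_self_eq_zero]

theorem syndrome_W₂_gauge (f : Γ.Face) {h : Pauli D} (hh : h ∈ gaugeGroup c) :
    syndrome (W₂ c f) h = 0 := by
  refine syndrome_gauge_eq_zero c (syndrome_W₂_linkOp c f) (fun u v huv => ?_) hh
  rw [W₂_x, W₂_x, huv]

open Classical in
theorem colorX_x (f : Γ.Face) :
    (Γ.colorX f).x = Γ.vertexSum fun q => if Γ.face q = f then 1 else 0 := by
  funext v
  rw [colorX, onSet_X_x, vertexSum_face]
  rfl

open Classical in
theorem colorZ_z (f : Γ.Face) :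
    (Γ.colorZ f).z = Γ.vertexSum fun q => if Γ.face q = f then 1 else 0 := by
  funext v
  rw [colorZ, onSet_Z_z, vertexSum_face]
  rfl

theorem colorSyndrome_eq (e : Pauli Γ.Vertex) (f : Γ.Face) :
    Γ.colorSyndrome e f = (Γ.colorX f).x ⬝ᵥ e.z := by
  rw [colorSyndrome, syndrome_eq, colorX, onSet_X_z, zero_dotProduct, add_zero]

/-- The rank-3 stabilizers see a `Z`-type error as the color code sees its projection. -/
theorem syndrome_W₂_of_isZType (f : Γ.Face) {e : Pauli D} (he : e.IsZType) :
    syndrome (W₂ c f) e = (Γ.colorX f).x ⬝ᵥ Γ.vertexSum e.z := by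
  classical
  rw [syndrome_eq, show e.x = 0 from he, dotProduct_zero, add_zero,
    dotProduct_comm _ (Γ.vertexSum e.z), vertexSum_dotProduct, dotProduct_comm]
  congr 1
  funext q
  rw [W₂_x, colorX, onSet_X_x]
  rfl

-- At `q` the operator of the face of `next⁻¹ q` has the letter `Y` exactly if `q` is red, and that
-- of the face of `next q` exactly if `q` is green; the letter is `X` otherwise. So `X_q`
-- anticommutes with exactly one of the two.
open Classical in
theorem affected_iff (q : D) (g : Γ.Face) : Affected c (Γ.face q) q g ↔
    g = if c.red q then Γ.face (Γ.next.symm q) else Γ.face (Γ.next q) := by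
  rw [Affected, syndrome_onSet_X_singleton, W₂_z]
  have h3 := Γ.face_next_ne q
  have h4 := Γ.face_next_symm_ne q
  have h5 := Γ.face_next_symm_ne_face_next q
  constructor
  · rintro ⟨hadj, h⟩
    have hne := Γ.ne_of_adjacent hadj
    rw [if_neg hne.symm] at h
    split_ifs at h ⊢ <;> simp_all
  · rintro rfl
    constructor
    · split_ifs
      · exact Γ.adjacent_face_next_symm q
      · exact Γ.adjacent_face_next q
    · split_ifs <;> simp_all

open Classical in
theorem syndrome_W₂_onSet_X (q : D) (g : Γ.Face) : syndrome (W₂ c g) (onSet Letter.X {q})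
    = if g = Γ.face q ∨ Affected c (Γ.face q) q g then 1 else 0 := by
  have h3 := Γ.face_next_ne q
  have h4 := Γ.face_next_symm_ne q
  have h5 := Γ.face_next_symm_ne_face_next q
  rw [affected_iff, syndrome_onSet_X_singleton, W₂_z]
  by_cases hr : c.red q <;> by_cases e1 : Γ.face q = g <;>
    by_cases e2 : Γ.face (Γ.next.symm q) = g <;> by_cases e3 : Γ.face (Γ.next q) = g <;>
    simp_all [eq_comm]

open Classical in
theorem syndrome_W₁_onSet_X (q : D) (f : Γ.Face) : syndrome (Γ.W₁ f) (onSet Letter.X {q})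
    = if Γ.face q = f then 1 else 0 := by
  rw [syndrome_onSet_X_singleton, W₁, onSet_Z_z]
  rfl

/-! ### The two loops of the decoder -/

-- A correction on a qubit of one face leaves the rank-2 syndromes of all others unchanged, and
-- `Nodup` ensures that no face is corrected twice.
open Classical in
theorem syndrome_W₁_foldl_xStep {pick : Γ.Face → D} (hpick : ∀ f, Γ.face (pick f) = f)
    (s₁ : Γ.Face → ZMod 2) (f : Γ.Face) (l : List Γ.Face) (hl : l.Nodup) (st : DecoderState Γ) :
    syndrome (Γ.W₁ f) (l.foldl (xStep c pick s₁) st).est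
      = syndrome (Γ.W₁ f) st.est + if f ∈ l then s₁ f else 0 := by
  induction l generalizing st with
  | nil => simp
  | cons g l ih =>
    rw [List.nodup_cons] at hl
    have hstep : syndrome (Γ.W₁ f) (xStep c pick s₁ st g).est
        = syndrome (Γ.W₁ f) st.est + if f = g then s₁ f else 0 := by
      have key : ∀ s : ZMod 2, s ≠ 0 → s = 1 := by decide
      unfold xStep
      by_cases h : s₁ g = 0
      · rw [if_neg (not_not.2 h)]
        split_ifs with h'
        · rw [h', h, add_zero]
        · rw [add_zero]
      · rw [if_pos h, syndrome_mul_right, syndrome_W₁_onSet_X, hpick]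
        by_cases h' : f = g
        · subst h'
          simp [key _ h]
        · simp [h', Ne.symm h']
    rw [List.foldl_cons, ih hl.2, hstep, add_assoc]
    congr 1
    by_cases h : f = g
    · subst h
      simp [hl.1]
    · simp [h]

/-- The loop invariant: the recorded rank-3 syndrome and that of the current estimate change
together, so their sum is preserved. -/
theorem syn_foldl_xStep {pick : Γ.Face → D} (hpick : ∀ f, Γ.face (pick f) = f)
    (s₁ : Γ.Face → ZMod 2) (g : Γ.Face) (l : List Γ.Face) (st : DecoderState Γ) :
    (l.foldl (xStep c pick s₁) st).syn g + syndrome (W₂ c g) (l.foldl (xStep c pick s₁) st).est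
      = st.syn g + syndrome (W₂ c g) st.est := by
  induction l generalizing st with
  | nil => rfl
  | cons f l ih =>
    rw [List.foldl_cons, ih]
    unfold xStep
    split_ifs with h
    · have := syndrome_W₂_onSet_X c (pick f) g
      rw [hpick] at this
      simp only [syndrome_mul_right, this]
      split_ifs
      · rw [add_add_add_comm, CharTwo.add_self_eq_zero, add_zero]
      · rw [add_zero]
    · rfl

theorem zPhase_x (vertices : List Γ.Vertex) (lift : Γ.Vertex → Set D) (Ω : Set Γ.Vertex)
    (est : Pauli D) : (zPhase vertices lift Ω est).x = est.x := by
  unfold zPhase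
  induction vertices generalizing est with
  | nil => rfl
  | cons v l ih =>
    rw [List.foldl_cons, ih]
    split_ifs
    · rw [mul_x, onSet_Z_x, add_zero]
    · rfl

/-- Both permitted lifts project to `Z_v`, since a triangle has three qubits and `3 = 1` modulo 2.
-/
theorem vertexSum_lift {lift : Γ.Vertex → Set D}
    (hlift : ∀ v, lift v = Γ.triangle v ∨ ∃ q ∈ Γ.triangle v, lift v = {q}) (v w : Γ.Vertex)
    [Decidable (v = w)] :
    Γ.vertexSum (onSet Letter.Z (lift v)).z w = if v = w then 1 else 0 := by
  rcases hlift v with h | ⟨q, hq, h⟩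
  · rw [h, vertexSum_triangle]
    congr
  · rw [h, vertexSum_singleton, show Γ.vertex q = v from hq]
    congr

open Classical in
theorem vertexSum_zPhase {lift : Γ.Vertex → Set D}
    (hlift : ∀ v, lift v = Γ.triangle v ∨ ∃ q ∈ Γ.triangle v, lift v = {q})
    (vertices : List Γ.Vertex) (hl : vertices.Nodup) (Ω : Set Γ.Vertex) (est : Pauli D)
    (w : Γ.Vertex) : Γ.vertexSum (zPhase vertices lift Ω est).z w
      = Γ.vertexSum est.z w + if w ∈ vertices ∧ w ∈ Ω then 1 else 0 := by
  unfold zPhase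
  induction vertices generalizing est with
  | nil => simp
  | cons v l ih =>
    rw [List.nodup_cons] at hl
    rw [List.foldl_cons, ih hl.2]
    by_cases hv : v ∈ Ω
    · rw [if_pos hv, mul_z, vertexSum_add, Pi.add_apply, vertexSum_lift hlift, add_assoc]
      congr 1
      by_cases h : v = w
      · subst h
        simp [hl.1, hv]
      · simp [h, Ne.symm h]
    · rw [if_neg hv]
      congr 1
      by_cases h : w = v
      · subst h
        simp [hv]
      · simp [h]

/-! ### The stabilizers of the two codes -/

theorem exists_face_of_mem_colorStabilizer {g : Pauli Γ.Vertex} (hg : g ∈ Γ.colorStabilizer) :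
    ∃ m : Γ.Face → ZMod 2, g.z = Γ.vertexSum fun q => m (Γ.face q) := by
  classical
  induction hg using Subgroup.closure_induction with
  | mem g hg =>
    rcases hg with ⟨f, rfl⟩ | ⟨f, rfl⟩
    · exact ⟨0, by rw [colorX, onSet_X_z]; exact Γ.vertexSum_zero.symm⟩
    · exact ⟨fun f' => if f' = f then 1 else 0, colorZ_z f⟩
  | one => exact ⟨0, Γ.vertexSum_zero.symm⟩
  | mul g h _ _ ihg ihh =>
    obtain ⟨m, hm⟩ := ihg
    obtain ⟨n, hn⟩ := ihh
    exact ⟨m + n, by rw [mul_z, hm, hn, ← vertexSum_add]; rfl⟩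
  | inv g _ ih => exact ih

theorem face_mem_vectors_colorStabilizer (m : Γ.Face → ZMod 2) :
    ((0, Γ.vertexSum fun q => m (Γ.face q)) : (Γ.Vertex → ZMod 2) × (Γ.Vertex → ZMod 2))
      ∈ vectors Γ.colorStabilizer := by
  classical
  have := Fintype.ofFinite Γ.Face
  have h : (((0, Γ.vertexSum fun q => m (Γ.face q)) :
      (Γ.Vertex → ZMod 2) × (Γ.Vertex → ZMod 2)))
      = ∑ f, m f • ((Γ.colorZ f).x, (Γ.colorZ f).z) := by
    simp only [colorZ_z]
    ext v
    · simp [Prod.fst_sum, colorZ, onSet_Z_x]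
    · simp only [Prod.snd_sum, Prod.smul_snd, Finset.sum_apply, Pi.smul_apply, vertexSum,
        smul_eq_mul, Finset.mul_sum]
      rw [Finset.sum_comm]
      simp
  rw [h]
  exact sum_mem fun f _ => smul_mem_vectors _
    (vectors_mem_of_mem (Subgroup.subset_closure (Or.inr ⟨f, rfl⟩)))

/-- A `Z`-type operator belongs to the gauge group exactly if its projection belongs to the
stabilizer of the color code, up to phases. -/
theorem mem_vectors_gaugeGroup_iff (z : D → ZMod 2) :
    ((0, z) : (D → ZMod 2) × (D → ZMod 2)) ∈ vectors (gaugeGroup c) ↔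
      ((0, Γ.vertexSum z) : (Γ.Vertex → ZMod 2) × (Γ.Vertex → ZMod 2))
        ∈ vectors Γ.colorStabilizer := by
  constructor
  · intro h
    obtain ⟨L, hx, hz⟩ := exists_links_of_mem_vectors c h
    -- A vanishing `X` part forces equal coefficients on consecutive links, hence a function of the
    -- face.
    have hL : ∀ p, L (Γ.along.symm p) = L p := fun p =>
      ((CharTwo.add_eq_zero).1 (congrFun hx p).symm).symm
    have hL' : ∀ p q, Γ.along.SameCycle p q → L p = L q := by
      intro p q hpq
      obtain ⟨k, -, rfl⟩ := hpq.exists_pow_eq'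
      clear hpq
      induction k with
      | zero => rfl
      | succ k ih =>
        rw [ih, pow_succ', Equiv.Perm.mul_apply, ← hL (Γ.along _), Equiv.symm_apply_apply]
    have hm : linkZ c L = fun q => Quotient.lift L hL' (Γ.face q) := by
      funext q
      simp only [linkZ, hL, ite_self]
      rfl
    rw [show Γ.vertexSum z = _ from hz, hm]
    exact face_mem_vectors_colorStabilizer _
  · rintro ⟨g, hg, -, hz⟩
    obtain ⟨m, hm⟩ := exists_face_of_mem_colorStabilizer hg
    -- Once the matching product of operators `W₁` is removed, `z` projects to zero and is a sum of
    -- pairs in triangles.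
    have h0 : Γ.vertexSum (z + fun q => m (Γ.face q)) = 0 := by
      rw [vertexSum_add, ← hm, hz]
      exact add_self_eq_zero_of_binary _
    have h1 := add_mem (mem_vectors_of_vertexSum_eq_zero c h0) (face_mem_vectors c m)
    rwa [Prod.mk_add_mk, add_zero, add_assoc, add_self_eq_zero_of_binary, add_zero] at h1

theorem syndrome_gauge_of_mem_stabilizer {h : Pauli D} (hh : h ∈ stabilizer c) :
    ∀ g ∈ gaugeGroup c, syndrome h g = 0 := fun g hg =>
  syndrome_eq_zero_of_comm (Subgroup.mem_centralizer_iff.1 hh.2 g hg).symm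

/-- The `X` part of a stabilizer is a sum of faces of `Γ`. -/
theorem exists_face_of_mem_stabilizer {h : Pauli D} (hh : h ∈ stabilizer c) :
    ∃ m : Γ.Face → ZMod 2,
      h.x = fun q => Γ.vertexSum (fun q => m (Γ.face q)) (Γ.vertex q) := by
  classical
  have hcomm := syndrome_gauge_of_mem_stabilizer c hh
  obtain ⟨L, hx, hz⟩ := exists_links c hh.1
  have hvert : ∀ u v, Γ.vertex u = Γ.vertex v → h.x u = h.x v := by
    intro u v huv
    by_cases hne : u = v
    · rw [hne]
    · have := hcomm _ (pairZ_mem_gaugeGroup c hne huv)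
      rwa [syndrome_pairZ h hne, CharTwo.add_eq_zero] at this
  -- The term `linkZ c L` is the coefficient of the green link at the qubit, and `h.x + linkZ c L`
  -- that of the red one. Across a red link commutation makes `h.z` agree at the two ends; across a
  -- green link it makes `h.x + h.z` agree. Either way the whole sum agrees, so it descends to a
  -- function of the face.
  have halong : ∀ d, h.x d + h.z d + linkZ c L d
      = h.x (Γ.along d) + h.z (Γ.along d) + linkZ c L (Γ.along d) := by
    intro d
    have hd := hcomm _ (linkOp_mem_gaugeGroup c d)
    rw [syndrome_linkOp] at hd
    have hx1 := congrFun hx d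
    have hx2 := congrFun hx (Γ.along d)
    simp only [linkX, Equiv.symm_apply_apply] at hx1 hx2
    simp only [linkZ, c.red_along, Equiv.symm_apply_apply]
    rw [hx1, hx2] at hd ⊢
    generalize L d = a at *
    generalize L (Γ.along d) = b at *
    generalize L (Γ.along.symm d) = e at *
    generalize h.z d = s at *
    generalize h.z (Γ.along d) = t at *
    clear hx hz hx1 hx2 hvert
    by_cases hr : c.red d
    · simp only [hr, if_true, not_true, if_false] at hd ⊢
      revert a b e s t
      decide
    · simp only [hr, if_true, not_false_eq_true, if_false] at hd ⊢
      revert a b e s t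
      decide
  have hface : ∀ p q, Γ.along.SameCycle p q →
      h.x p + h.z p + linkZ c L p = h.x q + h.z q + linkZ c L q := by
    intro p q hpq
    obtain ⟨k, -, rfl⟩ := hpq.exists_pow_eq'
    clear hpq
    induction k with
    | zero => rfl
    | succ k ih => rw [ih, pow_succ', Equiv.Perm.mul_apply, halong]
  refine ⟨Quotient.lift _ hface, ?_⟩
  have hx' : h.x = fun q => (fun v => h.x (Quotient.out v)) (Γ.vertex q) := by
    funext q
    exact hvert _ _ (Quotient.out_eq (Γ.vertex q)).symm
  -- Over a triangle `h.z` and `linkZ c L` have equal sums and cancel, while the constant `h.x` is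
  -- counted three times and survives.
  have key : Γ.vertexSum (h.x + h.z + linkZ c L) = fun v => h.x (Quotient.out v) := by
    rw [vertexSum_add, vertexSum_add, hz, add_assoc, add_self_eq_zero_of_binary, add_zero]
    conv_lhs => rw [hx']
    exact Γ.vertexSum_comp_vertex fun v => h.x (Quotient.out v)
  conv_lhs => rw [hx']
  funext q
  exact (congrFun key (Γ.vertex q)).symm

/-- Stabilizers commute with the `Z`-type errors whose projection has trivial syndrome. -/
theorem syndrome_stabilizer_eq_zero {h e : Pauli D} (hh : h ∈ stabilizer c) (he : e.IsZType)
    (hs : ∀ f, (Γ.colorX f).x ⬝ᵥ Γ.vertexSum e.z = 0) : syndrome h e = 0 := by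
  classical
  have := Fintype.ofFinite Γ.Face
  obtain ⟨m, hm⟩ := exists_face_of_mem_stabilizer c hh
  -- Adjointness is used twice: to carry the pairing down to vertices, and then back up so that the
  -- function `m` of the face stands on the qubits.
  rw [syndrome_eq, show e.x = 0 from he, dotProduct_zero, add_zero, hm, dotProduct_comm,
    ← vertexSum_dotProduct, dotProduct_comm, vertexSum_dotProduct]
  have h0 : ∀ f, ∑ q, (if Γ.face q = f then Γ.vertexSum e.z (Γ.vertex q) else 0) = 0 := by
    intro f
    have := hs f
    rw [colorX_x, vertexSum_dotProduct] at this
    simpa [dotProduct] using this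
  -- Grouping the qubits by face expresses the pairing as a combination of the color code syndromes,
  -- all of which vanish.
  calc (fun q => m (Γ.face q)) ⬝ᵥ (fun q => Γ.vertexSum e.z (Γ.vertex q))
      = ∑ f, m f * ∑ q, (if Γ.face q = f then Γ.vertexSum e.z (Γ.vertex q) else 0) := by
        simp only [Finset.mul_sum]
        rw [Finset.sum_comm]
        simp [dotProduct]
    _ = 0 := by simp only [h0, mul_zero, Finset.sum_const_zero]

end TwoColex

/-! ### Correctness of the decoder -/

theorem mainTheorem5 {D : Type*} [Fintype D] (Γ : TwoColex D) (c : Γ.RankTwoColoring)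
    (faces : List Γ.Face) (hfaces : faces.Nodup) (hfaces' : ∀ f, f ∈ faces)
    (vertices : List Γ.Vertex) (hvertices : vertices.Nodup) (hvertices' : ∀ v, v ∈ vertices)
    (pick : Γ.Face → D) (hpick : ∀ f, Γ.face (pick f) = f)
    (lift : Γ.Vertex → Set D)
    (hlift : ∀ v, lift v = Γ.triangle v ∨ ∃ q ∈ Γ.triangle v, lift v = {q})
    (dec : (Γ.Face → ZMod 2) → Pauli Γ.Vertex) (hdec : Γ.IsColorDecoder dec)
    (E : Pauli D) (s₁ s₂ : Γ.Face → ZMod 2)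
    (hs₁ : ∀ f, s₁ f = Pauli.syndrome (Γ.W₁ f) E)
    (hs₂ : ∀ f, s₂ f = Pauli.syndrome (TwoColex.W₂ c f) E)
    (st : TwoColex.DecoderState Γ) (hst : st = TwoColex.xPhase c faces pick s₁ s₂)
    (Ehat : Pauli D)
    (hEhat : Ehat = TwoColex.decode c faces vertices pick lift dec s₁ s₂) :
    -- the syndrome update of the first step concerns exactly one face besides `f`
    (∀ q : D, ∃! g : Γ.Face, TwoColex.Affected c (Γ.face q) q g) ∧
    -- the first step clears the rank-2 syndromes and keeps track of the rank-3 syndromes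
    (∀ f, Pauli.syndrome (Γ.W₁ f) (E * st.est) = 0) ∧
    (∀ f, Pauli.syndrome (TwoColex.W₂ c f) (E * st.est) = st.syn f) ∧
    -- the residual error is equivalent to a `Z`-type error modulo the gauge group
    (∃ F : Pauli D, F.IsZType ∧ Pauli.EquivMod (TwoColex.gaugeGroup c) (E * st.est) F) ∧
    -- every such `Z`-type error projects to an error on `Γ` with the updated syndrome, and the
    -- overall correction succeeds exactly if the decoder of the color code does
    (∀ F : Pauli D, F.IsZType → Pauli.EquivMod (TwoColex.gaugeGroup c) (E * st.est) F →
      Γ.colorSyndrome (Γ.proj F) = st.syn ∧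
      (Pauli.EquivMod (TwoColex.gaugeGroup c) E Ehat ↔
        Pauli.EquivMod Γ.colorStabilizer (Γ.proj F) (dec st.syn))) ∧
    -- the output has the input syndrome
    (∀ f, Pauli.syndrome (Γ.W₁ f) Ehat = s₁ f) ∧
    (∀ f, Pauli.syndrome (TwoColex.W₂ c f) Ehat = s₂ f) ∧
    (∀ h ∈ TwoColex.stabilizer c, Pauli.syndrome h Ehat = Pauli.syndrome h E) := by
  classical
  have hW₁ : ∀ (f : Γ.Face) (e e' : Pauli D), e.x = e'.x →
      Pauli.syndrome (Γ.W₁ f) e = Pauli.syndrome (Γ.W₁ f) e' := by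
    intro f e e' h
    rw [Pauli.syndrome_eq, Pauli.syndrome_eq, TwoColex.W₁, Pauli.onSet_Z_x, zero_dotProduct,
      zero_dotProduct, h]
  have hest₁ : ∀ f, Pauli.syndrome (Γ.W₁ f) st.est = s₁ f := by
    intro f
    rw [hst, TwoColex.xPhase, TwoColex.syndrome_W₁_foldl_xStep c hpick s₁ f faces hfaces,
      Pauli.syndrome_one_right, if_pos (hfaces' f), zero_add]
  have hest₂ : ∀ f, st.syn f + Pauli.syndrome (TwoColex.W₂ c f) st.est = s₂ f := by
    intro f
    rw [hst, TwoColex.xPhase, TwoColex.syn_foldl_xStep c hpick, Pauli.syndrome_one_right, add_zero]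
  have hres₁ : ∀ f, Pauli.syndrome (Γ.W₁ f) (E * st.est) = 0 := by
    intro f
    rw [Pauli.syndrome_mul_right, hest₁, hs₁, CharTwo.add_self_eq_zero]
  have hres₂ : ∀ f, Pauli.syndrome (TwoColex.W₂ c f) (E * st.est) = st.syn f := by
    intro f
    rw [Pauli.syndrome_mul_right, ← hs₂, ← hest₂, add_assoc, CharTwo.add_self_eq_zero, add_zero]
  have hF : ∃ F : Pauli D, F.IsZType ∧
      Pauli.EquivMod (TwoColex.gaugeGroup c) (E * st.est) F := by
    obtain ⟨z, hz⟩ := TwoColex.exists_mem_vectors_of_even c (x := (E * st.est).x)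
      fun f => (hW₁ f ⟨0, _, 0⟩ (E * st.est) rfl).trans (hres₁ f)
    -- Multiplication by the gauge operator with vector `(x, z)` cancels the `X` part of the
    -- residual error.
    refine ⟨⟨0, 0, (E * st.est).z + z⟩, rfl, Pauli.equivMod_iff.2 ?_⟩
    rwa [add_zero, ← add_assoc, add_self_eq_zero_of_binary, zero_add]
  have hsyn : ∀ F : Pauli D, F.IsZType →
      Pauli.EquivMod (TwoColex.gaugeGroup c) (E * st.est) F →
      Γ.colorSyndrome (Γ.proj F) = st.syn := by
    intro F hFz hFE
    funext f
    rw [TwoColex.colorSyndrome_eq, TwoColex.proj_z, ← TwoColex.syndrome_W₂_of_isZType c f hFz,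
      ← hres₂ f]
    exact (TwoColex.syndrome_eq_of_mem_vectors c (fun g hg => TwoColex.syndrome_W₂_gauge c f hg)
      (Pauli.equivMod_iff.1 hFE)).symm
  -- The decoder is only constrained on syndromes that occur; the projection of a `Z`-type residual
  -- error shows that the updated syndrome does.
  have hdecode : (dec st.syn).IsZType ∧ Γ.colorSyndrome (dec st.syn) = st.syn := by
    obtain ⟨F, hFz, hFE⟩ := hF
    have := hdec (Γ.proj F) rfl
    rwa [hsyn F hFz hFE] at this
  obtain ⟨hdecZ, hdecS⟩ := hdecode
  have hEhat' : Ehat = TwoColex.zPhase vertices lift (dec st.syn).support st.est := by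
    rw [hEhat, hst]
    rfl
  have hEhat_x : Ehat.x = st.est.x := by rw [hEhat', TwoColex.zPhase_x]
  have hEhat_z : Γ.vertexSum Ehat.z = Γ.vertexSum st.est.z + (dec st.syn).z := by
    funext v
    rw [hEhat', TwoColex.vertexSum_zPhase hlift vertices hvertices, Pi.add_apply]
    have key : ∀ s : ZMod 2, (if s ≠ 0 then 1 else 0) = s := by decide
    congr 1
    rw [← key ((dec st.syn).z v)]
    have : v ∈ (dec st.syn).support ↔ (dec st.syn).z v ≠ 0 := by
      have h0 : (dec st.syn).x v = 0 := congrFun hdecZ v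
      simp [Pauli.support, h0]
    simp [hvertices', this]
  -- The common argument for `W₂` and for arbitrary stabilizers: both commute with the gauge group
  -- and with `Z`-type errors of trivial projected syndrome.
  have hcomm : ∀ h : Pauli D, (∀ g ∈ TwoColex.gaugeGroup c, Pauli.syndrome h g = 0) →
      (∀ P : Pauli D, P.IsZType → (∀ f, (Γ.colorX f).x ⬝ᵥ Γ.vertexSum P.z = 0) →
        Pauli.syndrome h P = 0) → Pauli.syndrome h Ehat = Pauli.syndrome h E := by
    intro h hg hP
    obtain ⟨F, hFz, hFE⟩ := hF
    have hFs := hsyn F hFz hFE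
    -- Modulo the gauge group, `E` is `Ehat` times this `Z`-type operator. Its projection is the
    -- product of `π(F)` and the decoder output, which have equal syndromes.
    have hPz := hP ⟨0, 0, Ehat.z + st.est.z + F.z⟩ rfl ?_
    · have hmem := Pauli.equivMod_iff.1 hFE
      have := TwoColex.syndrome_eq_of_mem_vectors c hg (e := E)
        (e' := Ehat * ⟨0, 0, Ehat.z + st.est.z + F.z⟩) ?_
      · rw [this, Pauli.syndrome_mul_right, hPz, add_zero]
      · rw [show F.x = 0 from hFz] at hmem
        simp only [Pauli.mul_x, Pauli.mul_z, hEhat_x, add_zero] at hmem ⊢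
        rwa [add_assoc Ehat.z, ← add_assoc Ehat.z, add_self_eq_zero_of_binary, zero_add,
          ← add_assoc E.z]
    · intro f
      have h1 := congrFun hFs f
      rw [← hdecS, TwoColex.colorSyndrome_eq, TwoColex.colorSyndrome_eq, TwoColex.proj_z] at h1
      simp only [TwoColex.vertexSum_add, hEhat_z]
      rw [add_right_comm (Γ.vertexSum st.est.z), add_self_eq_zero_of_binary, zero_add,
        dotProduct_add, h1, CharTwo.add_self_eq_zero]
  refine ⟨fun q => ⟨_, (TwoColex.affected_iff c q _).2 rfl, fun g =>
    (TwoColex.affected_iff c q g).1⟩, hres₁, hres₂, hF, fun F hFz hFE => ⟨hsyn F hFz hFE, ?_⟩,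
    fun f => (hW₁ f _ _ hEhat_x).trans (hest₁ f), fun f => ?_, fun h hh => ?_⟩
  · have hmem := Pauli.equivMod_iff.1 hFE
    rw [Pauli.equivMod_iff, Pauli.equivMod_iff, TwoColex.proj_z,
      show (Γ.proj F).x = 0 from rfl, show (dec st.syn).x = 0 from hdecZ, add_zero]
    -- The `Z`-type operator on the right lifts the color code discrepancy. Adding it to the gauge
    -- vector relating `E * st.est` to `F` gives the vector that compares `E` with `Ehat`.
    have hz : Γ.vertexSum F.z + (dec st.syn).z = Γ.vertexSum (F.z + st.est.z + Ehat.z) := by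
      rw [TwoColex.vertexSum_add, TwoColex.vertexSum_add, hEhat_z, add_assoc,
        ← add_assoc (Γ.vertexSum st.est.z), add_self_eq_zero_of_binary, zero_add]
    rw [hz, ← TwoColex.mem_vectors_gaugeGroup_iff c,
      ← AddSubgroup.add_mem_cancel_left _ hmem (y := (0, F.z + st.est.z + Ehat.z))]
    rw [show F.x = 0 from hFz, hEhat_x]
    simp only [Pauli.mul_x, Pauli.mul_z, Prod.mk_add_mk, add_zero]
    have h2 : E.z + st.est.z + F.z + (F.z + st.est.z + Ehat.z) = E.z + Ehat.z := by
      calc _ = E.z + Ehat.z + (st.est.z + st.est.z) + (F.z + F.z) := by abel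
        _ = _ := by simp only [add_self_eq_zero_of_binary, add_zero]
    rw [h2]
  · rw [hs₂]
    exact hcomm _ (fun g hg => TwoColex.syndrome_W₂_gauge c f hg) fun P hP hPs =>
      (TwoColex.syndrome_W₂_of_isZType c f hP).trans (hPs f)
  · exact hcomm h (TwoColex.syndrome_gauge_of_mem_stabilizer c hh) fun P =>
      TwoColex.syndrome_stabilizer_eq_zero c hh
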